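/- Equip $\mathbb R^{M\times N}$ with the Frobenius inner product and norm. Let $k\le s$, let $\mathcal M_k$ be the set of matrices in $\mathbb R^{M\times N}$ of rank at most $k$, let $\mathcal N_s$ be the set of those with at most $s$ nonzero rows, and $\mathcal M_{k,s}=\mathcal M_k\cap\mathcal N_s$. For a set $S$ of row indices let $\mathcal M_{k,S}$ be the set of $X\in\mathcal M_k$ all of whose nonzero rows have index in $S$, and let $X_S$ be the matrix $X$ with the rows outside $S$ set to zero. Denote by $\mathbf H_s(X)=X_S$ the restriction to a set $S$ of $s$ rows of $X$ of largest Euclidean norm, and by $\mathbf T_k(X)$ a best approximation of $X$ in $\mathcal M_k$ in Frobenius norm; both may be set-valued, and any value may be chosen each time the operators are applied. Let $\mathbf A:\mathbb R^{M\times N}\to\mathbb R^m$ be linear with adjoint $\mathbf A^*$, and let $y\in\mathbb R^m$. Riemannian iterative hard thresholding with unit step size generates, from a starting point $X_1\in\mathcal M_{k,s}$ (for instance $X_1=(\mathbf T_k\circ\mathbf H_s)(\alpha_0\mathbf A^*y)$ with $\alpha_0\in\mathbb R$), the sequence $$X_{\ell+1}=(\mathbf T_k\circ\mathbf H_s)\bigl(X_\ell-\mathbf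 P_\ell\,\mathbf A^*(\mathbf A(X_\ell)-y)\bigr),\qquad \ell=1,2,\dots,$$ where $\mathbf P_\ell$ is the orthogonal projection onto the tangent space of $\mathcal M_k$ at $X_\ell$ if $\operatorname{rank}X_\ell=k$ and, in general, a metric projection onto the tangent cone of $\mathcal M_k$ at $X_\ell$. **Proposition.** Let $X^*\in\mathcal M_{k,s}$ satisfy $\mathbf A(X^*)=y$, have exactly $s$ nonzero rows, with index set $S^*$, and have rank $\min(k,s)$. Let $T=T_{X^*}\mathcal M_{k,S^*}$ be the tangent space of $\mathcal M_{k,S^*}$ at $X^*$, let $\mathbf P_T$ be the orthogonal projection onto $T$, and assume that the spectral norm of $\mathbf I-\mathbf A^*\mathbf A$ on $T$, $$\delta=\|\mathbf P_T(\mathbf I-\mathbf A^*\mathbf A)\mathbf P_T\|,$$ satisfies $\delta<1$. Then there is an $\epsilon>0$ such that, for every sequence $(X_\ell)_{\ell\ge1}$ generated as above, if $\|X_\ell-X^*\|_F\le\epsilon$ for some $\ell$, then $X_\ell\to X^*$ and $$\limsup_{\ell\to\infty}\frac{\|X_{\ell+1}-X^*\|_F}{\|X_\ell-X^*\|_F}\le\delta,$$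 where $0/0$ is read as $0$ (and $a/0$ as $\infty$ for $a>0$). -/

import Mathlib

open Filter Topology

noncomputable section

/-- The space `ℝ^{M × N}` of real `M × N` matrices. Its Euclidean inner product and norm are the
Frobenius inner product and the Frobenius norm. -/
abbrev MatSpace (M N : ℕ) : Type := EuclideanSpace ℝ (Fin M × Fin N)

namespace MatSpace

variable {M N : ℕ}

/-- The matrix with entries `X (i, j)`. -/
def toMatrix (X : MatSpace M N) : Matrix (Fin M) (Fin N) ℝ := Matrix.of fun i j => X (i, j)

/-- The `i`-th row of `X`, as a Euclidean vector. -/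
def row (X : MatSpace M N) (i : Fin M) : EuclideanSpace ℝ (Fin N) :=
  WithLp.toLp 2 fun j => X (i, j)

open Classical in
/-- The row support of `X`: the set of indices of its nonzero rows. -/
def rowSupport (X : MatSpace M N) : Finset (Fin M) := {i | X.row i ≠ 0}

/-- `X_S`: the matrix `X` with all rows not in `S` set to zero. -/
def rowRestrict (S : Finset (Fin M)) (X : MatSpace M N) : MatSpace M N :=
  WithLp.toLp 2 fun p => if p.1 ∈ S then X p else 0

end MatSpace

open MatSpace

/-- The set of matrices of rank at most `k`. -/
def lowRank (M N k : ℕ) : Set (MatSpace M N) := {X | X.toMatrix.rank ≤ k}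

/-- The set of row `s`-sparse matrices. -/
def rowSparse (M N s : ℕ) : Set (MatSpace M N) := {X | X.rowSupport.card ≤ s}

/-- The set of row `s`-sparse matrices of rank at most `k`. -/
def lowRankSparse (M N k s : ℕ) : Set (MatSpace M N) := lowRank M N k ∩ rowSparse M N s

/-- The variety of matrices of rank at most `k` whose nonzero rows all belong to the fixed set of
rows `S`. -/
def lowRankSupported {M : ℕ} (N k : ℕ) (S : Finset (Fin M)) : Set (MatSpace M N) :=
  {X | X ∈ lowRank M N k ∧ X.rowSupport ⊆ S}

/-- `Y` is a metric projection (a best approximation in Frobenius norm) of `Z` on the set `C`. -/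
def IsMetricProj {M N : ℕ} (C : Set (MatSpace M N)) (Z Y : MatSpace M N) : Prop :=
  Y ∈ C ∧ ∀ W ∈ C, ‖Z - Y‖ ≤ ‖Z - W‖

/-- `Y` is a value of the (possibly set-valued) hard thresholding operator `H_s` at `Z`: `Y = Z_S`
where `S` consists of `s` rows of `Z` of largest norm. -/
def IsHardThreshold {M N : ℕ} (s : ℕ) (Z Y : MatSpace M N) : Prop :=
  ∃ S : Finset (Fin M), S.card = s ∧ (∀ i ∈ S, ∀ j ∉ S, ‖Z.row j‖ ≤ ‖Z.row i‖) ∧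
    Y = Z.rowRestrict S

/-- `Y` is a value of the (possibly set-valued) quasi-optimal projection `T_k ∘ H_s` at `Z`, where
`T_k` is best approximation by matrices of rank at most `k`. -/
def IsQuasiProj {M N : ℕ} (k s : ℕ) (Z Y : MatSpace M N) : Prop :=
  ∃ W, IsHardThreshold s Z W ∧ IsMetricProj (lowRank M N k) W Y

/-- The gradient `A* (A X - y)` of the cost function `‖A X - y‖² / 2`. -/
def costGrad {M N m : ℕ} (A : MatSpace M N →L[ℝ] EuclideanSpace ℝ (Fin m))
    (y : EuclideanSpace ℝ (Fin m)) (X : MatSpace M N) : MatSpace M N :=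
  ContinuousLinearMap.adjoint A (A X - y)

/-- `X 1, X 2, …` is a sequence generated by Riemannian iterative hard thresholding with step sizes
`α ℓ > 0`, started at a point of `lowRankSparse M N k s` (the value `X 0` plays no role):
`X (ℓ + 1) = (T_k ∘ H_s) (X ℓ - α ℓ • P_ℓ (A* (A (X ℓ) - y)))`.
Here `P_ℓ` is the metric projection on the tangent cone of `lowRank M N k` at `X ℓ`; if `X ℓ` has
rank `k`, this cone is the tangent space and `P_ℓ` is the orthogonal projection on it. The values of
the projections may be chosen anew in every step. By `IsQuasiProj.mem_lowRankSparse`, the start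
`X 1 = (T_k ∘ H_s) (α₀ • A* y)` is included. -/
structure IsRiemannianIHT {M N m : ℕ} (A : MatSpace M N →L[ℝ] EuclideanSpace ℝ (Fin m))
    (y : EuclideanSpace ℝ (Fin m)) (k s : ℕ) (α : ℕ → ℝ) (X : ℕ → MatSpace M N) : Prop where
  start : X 1 ∈ lowRankSparse M N k s
  step_pos : ∀ ℓ, 1 ≤ ℓ → 0 < α ℓ
  step : ∀ ℓ, 1 ≤ ℓ → ∃ G : MatSpace M N,
    IsMetricProj (tangentConeAt ℝ (lowRank M N k) (X ℓ)) (costGrad A y (X ℓ)) G ∧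
    IsQuasiProj k s (X ℓ - α ℓ • G) (X (ℓ + 1))

/-- The tangent space at `X` of a set `C` which is a smooth manifold around `X`: the linear span of
the tangent directions. -/
def tangentSpaceOf {M N : ℕ} (C : Set (MatSpace M N)) (X : MatSpace M N) :
    Submodule ℝ (MatSpace M N) :=
  Submodule.span ℝ (tangentConeAt ℝ C X)

/-- The spectral norm of `B` on the subspace `T`, that is, of the compression `P_T B P_T`. -/
def spectralNormOn {M N : ℕ} (B : MatSpace M N →L[ℝ] MatSpace M N)
    (T : Submodule ℝ (MatSpace M N)) : ℝ :=
  ‖T.starProjection ∘L B ∘L T.starProjection‖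

theorem MatSpace.toMatrix_rowRestrict {M N : ℕ} (S : Finset (Fin M)) (X : MatSpace M N) :
    (X.rowRestrict S).toMatrix =
      Matrix.diagonal (fun i => if i ∈ S then (1 : ℝ) else 0) * X.toMatrix := by
  ext i j
  simp [toMatrix, rowRestrict, Matrix.diagonal_mul]

/-- The quasi-optimal projection `T_k ∘ H_s` takes its values in `lowRankSparse M N k s`. -/
theorem IsQuasiProj.mem_lowRankSparse {M N k s : ℕ} {Z Y : MatSpace M N}
    (h : IsQuasiProj k s Z Y) : Y ∈ lowRankSparse M N k s := by
  obtain ⟨W, ⟨S, hS, -, rfl⟩, hY, hbest⟩ := h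
  refine ⟨hY, ?_⟩
  have hr : Y.rowRestrict S ∈ lowRank M N k := by
    change (Y.rowRestrict S).toMatrix.rank ≤ k
    rw [toMatrix_rowRestrict]
    exact (Matrix.rank_mul_le_right _ _).trans hY
  have h1 := hbest _ hr
  rw [EuclideanSpace.norm_eq, EuclideanSpace.norm_eq, Real.sqrt_le_sqrt_iff (by positivity)] at h1
  have hle : ∀ p ∈ (Finset.univ : Finset (Fin M × Fin N)),
      ‖(Z.rowRestrict S - Y.rowRestrict S) p‖ ^ 2 ≤ ‖(Z.rowRestrict S - Y) p‖ ^ 2 := by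
    intro p _
    by_cases hp : p.1 ∈ S <;> simp [rowRestrict, hp, sq_nonneg]
  have heq := (Finset.sum_eq_sum_iff_of_le hle).1 (le_antisymm (Finset.sum_le_sum hle) h1)
  refine (Finset.card_le_card ?_).trans hS.le
  intro i hi
  by_contra hiS
  simp only [rowSupport, Finset.mem_filter, Finset.mem_univ, true_and] at hi
  apply hi
  ext j
  have := heq (i, j) (Finset.mem_univ _)
  simpa [rowRestrict, hiS, row] using this.symm

end

/-! Let `P` be the solution. Since `k ≤ s`, it has full rank `k`, so near `P` the set `lowRank M N
k` is a C¹ retract, via `X ↦ XJ(QXJ)⁻¹QX` for an invertible `k × k` compression `QXJ`. The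
derivative of a retraction is an idempotent whose range is the tangent cone; hence tangent spaces
vary continuously (`norm_starProjection_range_sub_le`) and a best approximation is, to first order,
orthogonal projection on the tangent space (`metricProj_isLittleO`). Since `P` has exactly `s`
nonzero rows, sparse iterates near `P` have its row support, and hard thresholding near `P` is the
linear restriction `D` to those rows. `D` preserves `lowRank` and fixes `P`, so it commutes with the
tangent projection `Q` at `P`, and `DQ` is a self-adjoint contraction into `T`. One step therefore
multiplies the error by `DQ(1 - A*A)DQ`, up to `o(‖X - P‖)` (`IsRiemannianIHTStep.isLittleO`), and
this operator has norm at most `δ`. Every rate above `δ` thus holds near `P`: one below `1` gives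
convergence, all of them give the limsup. -/

open MatSpace

/-! ### Local retractions, tangent cones and metric projections. -/

section Retraction

open Asymptotics

variable {E : Type*} [NormedAddCommGroup E] [InnerProductSpace ℝ E]

/-- `R` retracts a neighbourhood of `x` onto `C`, with derivative `L` at the point `x` of `C`. -/
structure HasLocalRetractionAt (R : E → E) (L : E →L[ℝ] E) (C : Set E) (x : E) : Prop where
  mem : x ∈ C
  map_mem : ∀ᶠ z in 𝓝 x, R z ∈ C
  map_eq : ∀ᶠ z in 𝓝 x, z ∈ C → R z = z
  hasFDerivAt : HasFDerivAt R L x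

namespace HasLocalRetractionAt

variable {R : E → E} {L : E →L[ℝ] E} {C : Set E} {x : E}

theorem apply_self (h : HasLocalRetractionAt R L C x) : R x = x :=
  h.map_eq.self_of_nhds h.mem

/-- Tangent vectors of `C` are fixed by the derivative of a local retraction. -/
theorem apply_of_mem_tangentConeAt (h : HasLocalRetractionAt R L C x) {v : E}
    (hv : v ∈ tangentConeAt ℝ C x) : L v = v := by
  -- Within `C` both `L` and the identity are derivatives of `R`; such derivatives agree on the
  -- tangent cone.
  have h1 : HasFDerivWithinAt R L C x := h.hasFDerivAt.hasFDerivWithinAt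
  have h2 : HasFDerivWithinAt R (ContinuousLinearMap.id ℝ E) C x := by
    refine (hasFDerivWithinAt_id x C).congr_of_eventuallyEq ?_ h.apply_self
    exact eventually_nhdsWithin_iff.2 h.map_eq
  exact h1.unique_on h2 hv

/-- `R` maps a full neighbourhood of `x`, where every direction is tangent, into `C`. -/
theorem apply_mem_tangentConeAt (h : HasLocalRetractionAt R L C x) (v : E) :
    L v ∈ tangentConeAt ℝ C x := by
  have h1 : HasFDerivWithinAt R L {z | R z ∈ C} x := h.hasFDerivAt.hasFDerivWithinAt
  have h2 : v ∈ tangentConeAt ℝ {z | R z ∈ C} x := by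
    rw [tangentConeAt_of_mem_nhds h.map_mem]
    trivial
  have h3 := h1.mapsTo_tangent_cone h2
  rw [h.apply_self] at h3
  refine tangentConeAt_mono ?_ h3
  rintro _ ⟨z, hz, rfl⟩
  exact hz

/-- The cone is thus a linear subspace, so metric projection on it is orthogonal projection. -/
theorem tangentConeAt_eq (h : HasLocalRetractionAt R L C x) :
    tangentConeAt ℝ C x = (L.range : Set E) := by
  ext v
  constructor
  · intro hv
    exact ⟨v, h.apply_of_mem_tangentConeAt hv⟩
  · rintro ⟨w, rfl⟩
    exact h.apply_mem_tangentConeAt w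

theorem idempotent (h : HasLocalRetractionAt R L C x) (v : E) : L (L v) = L v :=
  h.apply_of_mem_tangentConeAt (h.apply_mem_tangentConeAt v)

end HasLocalRetractionAt

variable [FiniteDimensional ℝ E]

/-- The orthogonal projection on a subspace is the only metric projection. -/
theorem Submodule.eq_starProjection_of_forall_norm_sub_le {T : Submodule ℝ E} {z g : E}
    (hg : g ∈ T) (h : ∀ w ∈ T, ‖z - g‖ ≤ ‖z - w‖) : g = T.starProjection z := by
  set q := T.starProjection z with hq
  have hmem : q ∈ T := T.starProjection_apply_mem z
  have hor : inner ℝ (z - q) (q - g) = 0 :=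
    T.starProjection_inner_eq_zero z _ (T.sub_mem hmem hg)
  have h1 := h q hmem
  have h2 : ‖z - g‖ ^ 2 = ‖z - q‖ ^ 2 + ‖q - g‖ ^ 2 := by
    have h3 := norm_add_sq_real (z - q) (q - g)
    rw [hor, sub_add_sub_cancel] at h3
    linarith
  have h4 : ‖z - g‖ ^ 2 ≤ ‖z - q‖ ^ 2 := by gcongr
  have h5 : ‖q - g‖ = 0 := by nlinarith [norm_nonneg (q - g)]
  exact (sub_eq_zero.1 (norm_eq_zero.1 h5)).symm

/-- The projection `u` is fixed by `L`, so `K u` lies within `‖L - K‖ * ‖u‖` of it, and the nearest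
point of the range of `K` is no farther. -/
theorem norm_sub_starProjection_range_apply_le {L K : E →L[ℝ] E} (hL : ∀ v, L (L v) = L v)
    (v : E) :
    ‖L.range.starProjection v - K.range.starProjection (L.range.starProjection v)‖ ≤
      ‖L - K‖ * ‖v‖ := by
  set u := L.range.starProjection v with hu
  have hLu : L u = u := by
    obtain ⟨w, hw⟩ := L.range.starProjection_apply_mem v
    change L w = u at hw
    rw [← hw, hL]
  calc ‖u - K.range.starProjection u‖ ≤ ‖u - K u‖ := by
        rw [K.range.starProjection_minimal]
        exact ciInf_le ⟨0, by rintro _ ⟨_, rfl⟩; exact norm_nonneg _⟩ (⟨K u, u, rfl⟩ : K.range)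
    _ = ‖(L - K) u‖ := by rw [sub_apply, hLu]
    _ ≤ ‖L - K‖ * ‖u‖ := (L - K).le_opNorm u
    _ ≤ ‖L - K‖ * ‖v‖ := by
        gcongr
        exact L.range.norm_starProjection_apply_le v

/-- Orthogonal projections on the ranges of idempotents depend continuously on the idempotents. -/
theorem norm_starProjection_range_sub_le {L K : E →L[ℝ] E} (hL : ∀ v, L (L v) = L v)
    (hK : ∀ v, K (K v) = K v) :
    ‖L.range.starProjection - K.range.starProjection‖ ≤ 2 * ‖L - K‖ := by
  set P := L.range.starProjection with hP
  set Q := K.range.starProjection with hQ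
  have h1 : ‖P - Q ∘L P‖ ≤ ‖L - K‖ :=
    ContinuousLinearMap.opNorm_le_bound _ (norm_nonneg _) fun v =>
      norm_sub_starProjection_range_apply_le hL v
  have h2 : ‖Q - P ∘L Q‖ ≤ ‖L - K‖ := by
    rw [norm_sub_rev L K]
    exact ContinuousLinearMap.opNorm_le_bound _ (norm_nonneg _) fun v =>
      norm_sub_starProjection_range_apply_le hK v
  have hPa : P.adjoint = P :=
    ContinuousLinearMap.isSelfAdjoint_iff'.1 (isSelfAdjoint_starProjection _)
  have hQa : Q.adjoint = Q :=
    ContinuousLinearMap.isSelfAdjoint_iff'.1 (isSelfAdjoint_starProjection _)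
  -- Self-adjointness moves the bound from `P - QP` to `P - PQ`.
  have h3 : P - P ∘L Q = ContinuousLinearMap.adjoint (P - Q ∘L P) := by
    rw [map_sub, ContinuousLinearMap.adjoint_comp, hPa, hQa]
  have h4 : ‖P - P ∘L Q‖ ≤ ‖L - K‖ := by
    rw [h3, LinearIsometryEquiv.norm_map]
    exact h1
  calc ‖P - Q‖ = ‖(P - P ∘L Q) - (Q - P ∘L Q)‖ := by congr 1; abel
    _ ≤ ‖L - K‖ + ‖L - K‖ := (norm_sub_le _ _).trans (add_le_add h4 h2)
    _ = 2 * ‖L - K‖ := by ring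

/-- Pythagoras for the decomposition of a vector by a subspace. -/
theorem Submodule.norm_sq_eq_starProjection (T : Submodule ℝ E) (v : E) :
    ‖v‖ ^ 2 = ‖T.starProjection v‖ ^ 2 + ‖v - T.starProjection v‖ ^ 2 := by
  have h := norm_add_sq_real (v - T.starProjection v) (T.starProjection v)
  rw [T.starProjection_inner_eq_zero v _ (T.starProjection_apply_mem v), sub_add_cancel] at h
  linarith

namespace HasLocalRetractionAt

variable {R : E → E} {L : E →L[ℝ] E} {C : Set E} {p : E}

theorem starProjection_apply (h : HasLocalRetractionAt R L C p) (v : E) :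
    L.range.starProjection (L v) = L v ∧ L (L.range.starProjection v) = L.range.starProjection v :=
  ⟨Submodule.starProjection_eq_self_iff.2 ⟨v, rfl⟩, by
    obtain ⟨w, hw⟩ := L.range.starProjection_apply_mem v
    change L w = _ at hw
    rw [← hw, h.idempotent]⟩

/-- Near `p`, the set `C` agrees to first order with its tangent space. -/
theorem sub_starProjection_isLittleO (h : HasLocalRetractionAt R L C p) {ι : Type*} {l : Filter ι}
    {x : ι → E} (hx : Tendsto x l (𝓝 p)) (hC : ∀ᶠ i in l, x i ∈ C) :
    (fun i => (x i - p) - L.range.starProjection (x i - p)) =o[l] fun i => x i - p := by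
  have h1 : (fun i => R (x i) - R p - L (x i - p)) =o[l] fun i => x i - p :=
    h.hasFDerivAt.isLittleO.comp_tendsto hx
  -- On `C` the map `R` is the identity, so `x - p` is `L (x - p)` up to a small error; the normal
  -- projection kills the `L` part.
  have h2 := ((ContinuousLinearMap.id ℝ E - L.range.starProjection).isBigO_comp
    (fun i => R (x i) - R p - L (x i - p)) l).trans_isLittleO h1
  refine h2.congr' ?_ EventuallyEq.rfl
  filter_upwards [hC, hx.eventually h.map_eq] with i hi hi'
  rw [hi' hi, h.apply_self]
  change x i - p - L (x i - p) - L.range.starProjection (x i - p - L (x i - p)) = _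
  rw [map_sub L.range.starProjection (x i - p), (h.starProjection_apply (x i - p)).1]
  abel

/-- First-order expansion of the metric projection on a set with a local retraction. -/
theorem metricProj_isLittleO (h : HasLocalRetractionAt R L C p) {ι : Type*} {l : Filter ι}
    {W Y : ι → E} (hW : Tendsto W l (𝓝 p))
    (hY : ∀ᶠ i in l, Y i ∈ C ∧ ∀ Z ∈ C, ‖W i - Y i‖ ≤ ‖W i - Z‖) :
    (fun i => (Y i - p) - L.range.starProjection (W i - p)) =o[l] fun i => W i - p := by
  set P := L.range.starProjection with hP
  have he0 : Tendsto (fun i => W i - p) l (𝓝 0) := by simpa using hW.sub_const p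
  have hdO : (fun i => Y i - p) =O[l] fun i => W i - p := by
    -- Comparing `Y` with the competitor `p` gives the factor 2.
    refine IsBigO.of_bound 2 ?_
    filter_upwards [hY] with i hi
    have h1 := hi.2 p h.mem
    calc ‖Y i - p‖ = ‖(W i - p) - (W i - Y i)‖ := by congr 1; abel
      _ ≤ ‖W i - p‖ + ‖W i - Y i‖ := norm_sub_le _ _
      _ ≤ 2 * ‖W i - p‖ := by linarith
  have hYp : Tendsto Y l (𝓝 p) := by
    simpa using (hdO.trans_tendsto he0).add_const p
  have hr1 : (fun i => (Y i - p) - P (Y i - p)) =o[l] fun i => W i - p :=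
    (h.sub_starProjection_isLittleO hYp (hY.mono fun i hi => hi.1)).trans_isBigO hdO
  have hPe : (fun i => P (W i - p)) =O[l] fun i => W i - p := P.isBigO_comp _ _
  have hz : Tendsto (fun i => p + P (W i - p)) l (𝓝 p) := by
    simpa using (hPe.trans_tendsto he0).const_add p
  have hr2 : (fun i => R (p + P (W i - p)) - p - P (W i - p)) =o[l] fun i => W i - p := by
    have h1 : (fun i => R (p + P (W i - p)) - R p - L (p + P (W i - p) - p)) =o[l]
        fun i => p + P (W i - p) - p := h.hasFDerivAt.isLittleO.comp_tendsto hz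
    simp only [add_sub_cancel_left, h.apply_self] at h1
    refine (h1.trans_isBigO hPe).congr_left fun i => ?_
    rw [(h.starProjection_apply (W i - p)).2]
  have hb : (fun i => (W i - p) - P (W i - p)) =O[l] fun i => W i - p := (isBigO_refl _ _).sub hPe
  -- The competitor `R (p + P e)` bounds the distance by `b + f`, where `b` is the normal part of
  -- `e` and `f` the retraction error. Since `Y` lies in `C`, the normal part of `d - e` is at least
  -- `b - c` with `c` small; Pythagoras leaves little for the tangential part.
  have key : ∀ᶠ i in l, ‖P ((Y i - p) - (W i - p))‖ ^ 2 ≤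
      (‖R (p + P (W i - p)) - p - P (W i - p)‖ + ‖(Y i - p) - P (Y i - p)‖) *
      (2 * ‖(W i - p) - P (W i - p)‖ + ‖R (p + P (W i - p)) - p - P (W i - p)‖ +
        ‖(Y i - p) - P (Y i - p)‖) := by
    filter_upwards [hY, hz.eventually h.map_mem] with i hi hi'
    have h1 := hi.2 _ hi'
    set e := W i - p with he
    set d := Y i - p with hd
    set r := R (p + P e) - p - P e with hr
    have h2 : W i - R (p + P e) = (e - P e) - r := by rw [hr, he]; abel
    have h3 : ‖W i - Y i‖ = ‖d - e‖ := by rw [norm_sub_rev, hd, he]; congr 1; abel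
    rw [h2, h3] at h1
    have h4 := L.range.norm_sq_eq_starProjection (d - e)
    rw [← hP] at h4
    have h5 : ‖d - e - P (d - e)‖ ≥ ‖e - P e‖ - ‖d - P d‖ := by
      have h6 : d - e - P (d - e) = (d - P d) - (e - P e) := by rw [map_sub]; abel
      rw [h6, norm_sub_rev]
      exact norm_sub_norm_le _ _
    have h7 : ‖e - P e - r‖ ≤ ‖e - P e‖ + ‖r‖ := norm_sub_le _ _
    have h8 : ‖d - e‖ ^ 2 ≤ (‖e - P e‖ + ‖r‖) ^ 2 := by
      gcongr
      exact h1.trans h7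
    set b := ‖e - P e‖
    set c := ‖d - P d‖
    set f := ‖r‖
    have hb0 : 0 ≤ b := norm_nonneg _
    have hc0 : 0 ≤ c := norm_nonneg _
    have hf0 : 0 ≤ f := norm_nonneg _
    have h9 : (‖d - e - P (d - e)‖) ^ 2 ≥ b ^ 2 - 2 * b * c - c ^ 2 := by
      have h10 := norm_nonneg (d - e - P (d - e))
      rcases le_total b c with hbc | hbc
      · nlinarith
      · nlinarith
    nlinarith
  -- The bound on the square is a little-o times a big-O of the error; take square roots.
  have ha : (fun i => P ((Y i - p) - (W i - p))) =o[l] fun i => W i - p := by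
    have h1 : (fun i => ‖P ((Y i - p) - (W i - p))‖ ^ 2) =O[l] fun i =>
        (‖R (p + P (W i - p)) - p - P (W i - p)‖ + ‖(Y i - p) - P (Y i - p)‖) *
        (2 * ‖(W i - p) - P (W i - p)‖ + ‖R (p + P (W i - p)) - p - P (W i - p)‖ +
          ‖(Y i - p) - P (Y i - p)‖) := by
      refine IsBigO.of_bound 1 ?_
      filter_upwards [key] with i hi
      rw [Real.norm_of_nonneg (by positivity), one_mul]
      exact hi.trans (le_abs_self _)
    have h2 := ((hr2.norm_norm.add hr1.norm_norm).mul_isBigO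
      (((hb.norm_norm.const_mul_left 2).add hr2.norm_norm.isBigO).add hr1.norm_norm.isBigO))
    have h3 := h1.trans_isLittleO h2
    simp only [← pow_two] at h3
    exact (h3.of_pow two_ne_zero).of_norm_norm
  refine (hr1.add ha).congr_left fun i => ?_
  rw [map_sub P (Y i - p)]
  abel

end HasLocalRetractionAt

end Retraction

/-! ### Smoothness of matrix products, determinants and inverses. -/

section MatrixSmooth

open Matrix

variable {E : Type*} [NormedAddCommGroup E] [NormedSpace ℝ E] {n : WithTop ℕ∞} {x : E}
variable {a b c : Type*}

theorem contDiffAt_matrix_mul [Fintype b] {F : E → Matrix a b ℝ} {G : E → Matrix b c ℝ}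
    (hF : ∀ i j, ContDiffAt ℝ n (fun z => F z i j) x)
    (hG : ∀ i j, ContDiffAt ℝ n (fun z => G z i j) x) (i : a) (j : c) :
    ContDiffAt ℝ n (fun z => (F z * G z) i j) x := by
  simp only [Matrix.mul_apply]
  exact ContDiffAt.sum fun r _ => (hF i r).mul (hG r j)

theorem contDiffAt_matrix_det [Fintype a] [DecidableEq a] {F : E → Matrix a a ℝ}
    (hF : ∀ i j, ContDiffAt ℝ n (fun z => F z i j) x) :
    ContDiffAt ℝ n (fun z => (F z).det) x := by
  simp only [Matrix.det_apply]
  exact ContDiffAt.sum fun σ _ => (contDiffAt_prod fun i _ => hF (σ i) i).const_smul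
    (Equiv.Perm.sign σ : ℤ)

/-- Cramer's rule: entries of the adjugate are determinants of row-updated matrices. -/
theorem contDiffAt_matrix_inv [Fintype a] [DecidableEq a] {F : E → Matrix a a ℝ}
    (hF : ∀ i j, ContDiffAt ℝ n (fun z => F z i j) x) (hx : (F x).det ≠ 0) (i j : a) :
    ContDiffAt ℝ n (fun z => (F z)⁻¹ i j) x := by
  simp only [Matrix.inv_def, Matrix.smul_apply, Ring.inverse_eq_inv', smul_eq_mul]
  refine ((contDiffAt_matrix_det hF).inv hx).mul ?_
  simp only [Matrix.adjugate_apply]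
  refine contDiffAt_matrix_det fun r t => ?_
  by_cases hr : r = j
  · subst hr
    simpa using contDiffAt_const
  · simpa [Matrix.updateRow_ne hr] using hF r t

end MatrixSmooth

/-! ### A smooth retraction onto matrices of bounded rank. -/

section RankRetraction

variable {M N k : ℕ}

/-- A matrix of rank `k` has a `k × k` compression equal to the identity. -/
theorem Matrix.exists_mul_mul_eq_one_of_rank {X : Matrix (Fin M) (Fin N) ℝ} (hX : X.rank = k) :
    ∃ (Q : Matrix (Fin k) (Fin M) ℝ) (J : Matrix (Fin N) (Fin k) ℝ), Q * X * J = 1 := by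
  set f := X.mulVecLin with hf
  have hr : Module.finrank ℝ f.range = k := hX
  let e : f.range ≃ₗ[ℝ] (Fin k → ℝ) := LinearEquiv.ofFinrankEq _ _ (by simp [hr])
  -- With `g` a section of `X` over its range and `q` a projection on that range, `Q = e q` and `J =
  -- g e⁻¹` give `QXJ = 1`.
  obtain ⟨g, hg⟩ := f.rangeRestrict.exists_rightInverse_of_surjective f.range_rangeRestrict
  obtain ⟨q, hq⟩ := f.range.subtype.exists_leftInverse_of_injective f.range.ker_subtype
  refine ⟨LinearMap.toMatrix' (e.toLinearMap ∘ₗ q),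
    LinearMap.toMatrix' (g ∘ₗ e.symm.toLinearMap), ?_⟩
  have hXf : X = LinearMap.toMatrix' f := (LinearMap.toMatrix'_toLin' X).symm
  conv_lhs => rw [hXf]
  rw [← LinearMap.toMatrix'_comp, ← LinearMap.toMatrix'_comp, ← LinearMap.toMatrix'_id]
  congr 1
  refine LinearMap.ext fun v => ?_
  have h1 : f (g (e.symm v)) = (e.symm v : f.range) := by
    have := LinearMap.congr_fun hg (e.symm v)
    exact congrArg Subtype.val this
  have h2 : q ((e.symm v : f.range) : Fin M → ℝ) = e.symm v := LinearMap.congr_fun hq (e.symm v)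
  simp [h1, h2]

/-- Reconstruction of a matrix of rank at most `k` from an invertible `k × k` compression. -/
theorem Matrix.mul_inv_mul_eq_of_rank_le {X : Matrix (Fin M) (Fin N) ℝ} (hX : X.rank ≤ k)
    {Q : Matrix (Fin k) (Fin M) ℝ} {J : Matrix (Fin N) (Fin k) ℝ} (h : (Q * X * J).det ≠ 0) :
    X * J * (Q * X * J)⁻¹ * (Q * X) = X := by
  have hu : IsUnit (Q * X * J).det := isUnit_iff_ne_zero.2 h
  -- The invertible compression forces `XJ` to have rank `k`, hence the same column space as `X`. So
  -- `Xv = XJw`, and `w` is recovered from `QXv = (QXJ)w`.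
  have hrk : (X * J).rank = k := by
    apply le_antisymm ((Matrix.rank_mul_le_left _ _).trans hX)
    have h1 : (Q * X * J).rank = k := by
      simpa using Matrix.rank_of_isUnit _ ((Matrix.isUnit_iff_isUnit_det _).2 hu)
    rw [Matrix.mul_assoc] at h1
    exact h1.ge.trans (Matrix.rank_mul_le_right _ _)
  have hle : (X * J).mulVecLin.range ≤ X.mulVecLin.range := by
    rw [Matrix.mulVecLin_mul]
    exact LinearMap.range_comp_le_range _ _
  have heq : (X * J).mulVecLin.range = X.mulVecLin.range :=
    Submodule.eq_of_le_of_finrank_le hle (hX.trans hrk.ge)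
  refine Matrix.toLin'.injective (LinearMap.ext fun v => ?_)
  have hv : X.mulVecLin v ∈ (X * J).mulVecLin.range := heq ▸ ⟨v, rfl⟩
  obtain ⟨w, hw⟩ := hv
  simp only [Matrix.mulVecLin_apply] at hw
  have h1 : (Q * X).mulVec v = (Q * X * J).mulVec w := by
    rw [← Matrix.mulVec_mulVec, ← hw, Matrix.mulVec_mulVec, Matrix.mul_assoc]
  rw [Matrix.toLin'_apply, Matrix.toLin'_apply, ← Matrix.mulVec_mulVec, h1, Matrix.mulVec_mulVec,
    Matrix.nonsing_inv_mul_cancel_right _ _ hu, hw]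

/-- The matrix with the same `k × k` compression, rows `Q X` and columns `X J` as `X`, and of rank at
most `k`. -/
noncomputable def rankRetraction (Q : Matrix (Fin k) (Fin M) ℝ) (J : Matrix (Fin N) (Fin k) ℝ)
    (X : MatSpace M N) : MatSpace M N :=
  WithLp.toLp 2 fun p =>
    (X.toMatrix * J * (Q * X.toMatrix * J)⁻¹ * (Q * X.toMatrix)) p.1 p.2

theorem toMatrix_rankRetraction (Q : Matrix (Fin k) (Fin M) ℝ) (J : Matrix (Fin N) (Fin k) ℝ)
    (X : MatSpace M N) : (rankRetraction Q J X).toMatrix =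
      X.toMatrix * J * (Q * X.toMatrix * J)⁻¹ * (Q * X.toMatrix) := by
  ext i j
  rfl

/-- The product factors through `ℝ^k`, so a singular compression does no harm. -/
theorem rankRetraction_mem (Q : Matrix (Fin k) (Fin M) ℝ) (J : Matrix (Fin N) (Fin k) ℝ)
    (X : MatSpace M N) : rankRetraction Q J X ∈ lowRank M N k := by
  change (rankRetraction Q J X).toMatrix.rank ≤ k
  rw [toMatrix_rankRetraction]
  refine (Matrix.rank_mul_le_right _ _).trans ?_
  exact (Matrix.rank_le_card_height _).trans (by simp)

theorem contDiffAt_toMatrix_apply {n : WithTop ℕ∞} (X : MatSpace M N) (i : Fin M) (j : Fin N) :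
    ContDiffAt ℝ n (fun Z : MatSpace M N => Z.toMatrix i j) X :=
  contDiffAt_euclidean.1 contDiffAt_id (i, j)

theorem contDiffAt_compression {n : WithTop ℕ∞} (Q : Matrix (Fin k) (Fin M) ℝ)
    (J : Matrix (Fin N) (Fin k) ℝ) (X : MatSpace M N) (i j : Fin k) :
    ContDiffAt ℝ n (fun Z : MatSpace M N => (Q * Z.toMatrix * J) i j) X :=
  contDiffAt_matrix_mul (F := fun Z : MatSpace M N => Q * Z.toMatrix) (G := fun _ => J)
    (contDiffAt_matrix_mul (F := fun _ : MatSpace M N => Q) (G := fun Z => Z.toMatrix)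
      (fun _ _ => contDiffAt_const) (contDiffAt_toMatrix_apply X))
    (fun _ _ => contDiffAt_const) i j

theorem contDiffAt_rankRetraction {n : WithTop ℕ∞} {Q : Matrix (Fin k) (Fin M) ℝ}
    {J : Matrix (Fin N) (Fin k) ℝ} {X : MatSpace M N} (h : (Q * X.toMatrix * J).det ≠ 0) :
    ContDiffAt ℝ n (rankRetraction Q J) X := by
  rw [contDiffAt_euclidean]
  rintro ⟨i, j⟩
  have h1 : ∀ i j, ContDiffAt ℝ n (fun Z : MatSpace M N => (Z.toMatrix * J) i j) X :=
    contDiffAt_matrix_mul (F := fun Z : MatSpace M N => Z.toMatrix) (G := fun _ => J)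
      (contDiffAt_toMatrix_apply X) (fun _ _ => contDiffAt_const)
  have h2 : ∀ i j, ContDiffAt ℝ n (fun Z : MatSpace M N => (Q * Z.toMatrix) i j) X :=
    contDiffAt_matrix_mul (F := fun _ : MatSpace M N => Q) (G := fun Z => Z.toMatrix)
      (fun _ _ => contDiffAt_const) (contDiffAt_toMatrix_apply X)
  have h3 : ∀ i j, ContDiffAt ℝ n (fun Z : MatSpace M N => (Q * Z.toMatrix * J)⁻¹ i j) X :=
    contDiffAt_matrix_inv (F := fun Z : MatSpace M N => Q * Z.toMatrix * J)
      (contDiffAt_compression Q J X) h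
  exact contDiffAt_matrix_mul
    (F := fun Z : MatSpace M N => Z.toMatrix * J * (Q * Z.toMatrix * J)⁻¹)
    (G := fun Z => Q * Z.toMatrix)
    (contDiffAt_matrix_mul (F := fun Z : MatSpace M N => Z.toMatrix * J)
      (G := fun Z => (Q * Z.toMatrix * J)⁻¹) h1 h3) h2 i j

theorem rankRetraction_eq_self {Q : Matrix (Fin k) (Fin M) ℝ} {J : Matrix (Fin N) (Fin k) ℝ}
    {X : MatSpace M N} (hX : X ∈ lowRank M N k) (h : (Q * X.toMatrix * J).det ≠ 0) :
    rankRetraction Q J X = X := by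
  have h1 := toMatrix_rankRetraction Q J X
  rw [Matrix.mul_inv_mul_eq_of_rank_le hX h] at h1
  ext ⟨i, j⟩
  exact congrFun (congrFun h1 i) j

theorem eventually_det_compression_ne_zero {Q : Matrix (Fin k) (Fin M) ℝ}
    {J : Matrix (Fin N) (Fin k) ℝ} {X : MatSpace M N} (h : (Q * X.toMatrix * J).det ≠ 0) :
    ∀ᶠ Z in 𝓝 X, (Q * Z.toMatrix * J).det ≠ 0 :=
  (contDiffAt_matrix_det (n := 1) (F := fun Z : MatSpace M N => Q * Z.toMatrix * J)
    (contDiffAt_compression Q J X)).continuousAt.eventually_ne h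

theorem hasLocalRetractionAt_rankRetraction {Q : Matrix (Fin k) (Fin M) ℝ}
    {J : Matrix (Fin N) (Fin k) ℝ} {X : MatSpace M N} (hX : X ∈ lowRank M N k)
    (h : (Q * X.toMatrix * J).det ≠ 0) :
    HasLocalRetractionAt (rankRetraction Q J) (fderiv ℝ (rankRetraction Q J) X)
      (lowRank M N k) X where
  mem := hX
  map_mem := Eventually.of_forall fun Z => rankRetraction_mem Q J Z
  map_eq := by
    filter_upwards [eventually_det_compression_ne_zero h] with Z hZ hZ'
    exact rankRetraction_eq_self hZ' hZ
  hasFDerivAt :=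
    ((contDiffAt_rankRetraction (n := 1) h).differentiableAt one_ne_zero).hasFDerivAt

/-- Around a matrix of rank `k`, the set of matrices of rank at most `k` is a continuously
differentiable retract. -/
theorem exists_hasLocalRetractionAt_lowRank {X : MatSpace M N} (hX : X.toMatrix.rank = k) :
    ∃ (R : MatSpace M N → MatSpace M N) (L : MatSpace M N → MatSpace M N →L[ℝ] MatSpace M N),
      ContinuousAt L X ∧
      ∀ᶠ Z in 𝓝 X, Z ∈ lowRank M N k → HasLocalRetractionAt R (L Z) (lowRank M N k) Z := by
  obtain ⟨Q, J, hQJ⟩ := Matrix.exists_mul_mul_eq_one_of_rank hX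
  have h : (Q * X.toMatrix * J).det ≠ 0 := by simp [hQJ]
  refine ⟨rankRetraction Q J, fderiv ℝ (rankRetraction Q J), ?_, ?_⟩
  · exact ((contDiffAt_rankRetraction (n := 1) h).fderiv_right (m := 0) (by simp)).continuousAt
  · filter_upwards [eventually_det_compression_ne_zero h] with Z hZ hZ'
    exact hasLocalRetractionAt_rankRetraction hZ' hZ

end RankRetraction

/-! ### Row restriction and hard thresholding near a matrix with `s` nonzero rows. -/

section RowRestriction

variable {M N k s : ℕ}

/-- Restriction to the rows in `S`, as a continuous linear map. -/
noncomputable def rowRestrictL (N : ℕ) {M : ℕ} (S : Finset (Fin M)) :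
    MatSpace M N →L[ℝ] MatSpace M N :=
  LinearMap.toContinuousLinearMap
    { toFun := MatSpace.rowRestrict S
      map_add' := fun X Y => by
        ext p
        by_cases hp : p.1 ∈ S <;> simp [rowRestrict, hp]
      map_smul' := fun c X => by
        ext p
        by_cases hp : p.1 ∈ S <;> simp [rowRestrict, hp] }

theorem rowRestrictL_apply (S : Finset (Fin M)) (X : MatSpace M N) :
    rowRestrictL N S X = X.rowRestrict S := rfl

theorem rowRestrict_apply (S : Finset (Fin M)) (X : MatSpace M N) (p : Fin M × Fin N) :
    X.rowRestrict S p = if p.1 ∈ S then X p else 0 := rfl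

theorem inner_rowRestrictL_left (S : Finset (Fin M)) (X Y : MatSpace M N) :
    inner ℝ (rowRestrictL N S X) Y = inner ℝ X (rowRestrictL N S Y) := by
  simp only [rowRestrictL_apply, PiLp.inner_apply, rowRestrict_apply]
  refine Finset.sum_congr rfl fun p _ => ?_
  by_cases hp : p.1 ∈ S <;> simp [hp]

theorem adjoint_rowRestrictL (S : Finset (Fin M)) :
    ContinuousLinearMap.adjoint (rowRestrictL N S) = rowRestrictL N S :=
  ((ContinuousLinearMap.eq_adjoint_iff _ _).2 (inner_rowRestrictL_left S)).symm

theorem norm_rowRestrictL_le (S : Finset (Fin M)) (X : MatSpace M N) :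
    ‖rowRestrictL N S X‖ ≤ ‖X‖ := by
  rw [EuclideanSpace.norm_eq, EuclideanSpace.norm_eq]
  refine Real.sqrt_le_sqrt (Finset.sum_le_sum fun p _ => ?_)
  rw [rowRestrictL_apply, rowRestrict_apply]
  by_cases hp : p.1 ∈ S <;> simp [hp]
  positivity

theorem mem_rowSupport {X : MatSpace M N} {i : Fin M} : i ∈ X.rowSupport ↔ X.row i ≠ 0 := by
  simp [rowSupport]

theorem rowRestrict_eq_self {S : Finset (Fin M)} {X : MatSpace M N} (h : X.rowSupport ⊆ S) :
    X.rowRestrict S = X := by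
  ext p
  rw [rowRestrict_apply]
  split_ifs with hp
  · rfl
  · have h1 : X.row p.1 = 0 := by
      by_contra h2
      exact hp (h (mem_rowSupport.2 h2))
    exact (congrArg (fun v : EuclideanSpace ℝ (Fin N) => v p.2) h1).symm

theorem rowSupport_rowRestrict_subset (S : Finset (Fin M)) (X : MatSpace M N) :
    (X.rowRestrict S).rowSupport ⊆ S := by
  intro i hi
  by_contra hiS
  apply mem_rowSupport.1 hi
  ext j
  simp [row, rowRestrict, hiS]

theorem rowRestrict_mem_lowRank (S : Finset (Fin M)) {X : MatSpace M N} (hX : X ∈ lowRank M N k) :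
    X.rowRestrict S ∈ lowRank M N k := by
  change (X.rowRestrict S).toMatrix.rank ≤ k
  rw [toMatrix_rowRestrict]
  exact (Matrix.rank_mul_le_right _ _).trans hX

theorem continuous_row (i : Fin M) : Continuous fun X : MatSpace M N => X.row i := by
  unfold row
  fun_prop

/-- Row sparse matrices near a matrix with exactly `s` nonzero rows have the same row support. -/
theorem eventually_rowSupport_eq {P : MatSpace M N} (hP : P.rowSupport.card = s) :
    ∀ᶠ X in 𝓝 P, X ∈ rowSparse M N s → X.rowSupport = P.rowSupport := by
  have h1 : ∀ᶠ X : MatSpace M N in 𝓝 P, ∀ i ∈ P.rowSupport, X.row i ≠ 0 := by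
    rw [Finset.eventually_all]
    intro i hi
    exact (continuous_row i).continuousAt.eventually_ne (mem_rowSupport.1 hi)
  filter_upwards [h1] with X hX hs
  have h2 : X.rowSupport.card ≤ s := hs
  -- Nonzero rows persist, so the support can only grow, and its size is capped at `s`.
  exact (Finset.eq_of_subset_of_card_le (fun i hi => mem_rowSupport.2 (hX i hi))
    (h2.trans hP.ge)).symm

/-- Near a matrix with exactly `s` nonzero rows, hard thresholding is restriction to these rows. -/
theorem eventually_isHardThreshold_eq {P : MatSpace M N} (hP : P.rowSupport.card = s) :
    ∀ᶠ Z in 𝓝 P, ∀ W, IsHardThreshold s Z W → W = Z.rowRestrict P.rowSupport := by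
  have h1 : ∀ᶠ Z : MatSpace M N in 𝓝 P, ∀ i ∈ P.rowSupport, ∀ j ∈ P.rowSupportᶜ,
      ‖Z.row j‖ < ‖Z.row i‖ := by
    rw [Finset.eventually_all]
    intro i hi
    rw [Finset.eventually_all]
    intro j hj
    refine ((continuous_row j).norm.continuousAt).eventually_lt
      ((continuous_row i).norm.continuousAt) ?_
    have hj' : P.row j = 0 := by
      by_contra h
      exact Finset.mem_compl.1 hj (mem_rowSupport.2 h)
    rw [hj', norm_zero]
    exact norm_pos_iff.2 (mem_rowSupport.1 hi)
  filter_upwards [h1] with Z hZ W hW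
  obtain ⟨S, hS, hmax, rfl⟩ := hW
  -- A row chosen outside the support would, by cardinality, displace a strictly larger row of the
  -- support.
  have hsub : S ⊆ P.rowSupport := by
    by_contra hne
    obtain ⟨j, hjS, hj⟩ := Finset.not_subset.1 hne
    have hne' : ¬ P.rowSupport ⊆ S := fun h =>
      hne (Finset.eq_of_subset_of_card_le h (hS.trans hP.symm).le).ge
    obtain ⟨i, hi, hiS⟩ := Finset.not_subset.1 hne'
    exact absurd (hmax j hjS i hiS) (not_le.2 (hZ i hi j (Finset.mem_compl.2 hj)))
  rw [Finset.eq_of_subset_of_card_le hsub (hP.trans hS.symm).le]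

end RowRestriction

/-! ### Linearization of one step and local contraction. -/

section LocalConvergence

open Asymptotics

variable {M N m k s : ℕ}

/-- Commutation of an orthogonal projection with a self-adjoint operator leaving its range
invariant. -/
theorem Submodule.starProjection_comm_of_invariant {E : Type*} [NormedAddCommGroup E]
    [InnerProductSpace ℝ E] [FiniteDimensional ℝ E] {T : Submodule ℝ E} {D : E →L[ℝ] E}
    (hD : ContinuousLinearMap.adjoint D = D) (hT : ∀ v ∈ T, D v ∈ T) (v : E) :
    T.starProjection (D v) = D (T.starProjection v) := by
  -- Invariance gives `PDP = DP`; its adjoint reads `PDP = PD`.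
  have h1 : T.starProjection ∘L D ∘L T.starProjection = D ∘L T.starProjection :=
    ContinuousLinearMap.ext fun w =>
      Submodule.starProjection_eq_self_iff.2 (hT _ (T.starProjection_apply_mem w))
  have hPa : ContinuousLinearMap.adjoint T.starProjection = T.starProjection :=
    ContinuousLinearMap.isSelfAdjoint_iff'.1 (isSelfAdjoint_starProjection _)
  have h2 := congrArg ContinuousLinearMap.adjoint h1
  simp only [ContinuousLinearMap.adjoint_comp, hPa, hD] at h2
  rw [ContinuousLinearMap.comp_assoc, h1] at h2
  exact (congrArg (fun F : E →L[ℝ] E => F v) h2).symm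

/-- The compression of `B` by a self-adjoint contraction `D` with range in `T` is bounded by the
spectral norm of `B` on `T`. -/
theorem norm_compression_apply_le {D B : MatSpace M N →L[ℝ] MatSpace M N}
    {T : Submodule ℝ (MatSpace M N)} (hDa : ContinuousLinearMap.adjoint D = D)
    (hD1 : ∀ v, ‖D v‖ ≤ ‖v‖) (hDT : ∀ v, D v ∈ T) (v : MatSpace M N) :
    ‖D (B (D v))‖ ≤ spectralNormOn B T * ‖v‖ := by
  have hPa : ContinuousLinearMap.adjoint T.starProjection = T.starProjection :=
    ContinuousLinearMap.isSelfAdjoint_iff'.1 (isSelfAdjoint_starProjection _)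
  have h1 : T.starProjection ∘L D = D :=
    ContinuousLinearMap.ext fun w => Submodule.starProjection_eq_self_iff.2 (hDT w)
  have h2 : D ∘L T.starProjection = D := by
    have h := congrArg ContinuousLinearMap.adjoint h1
    rwa [ContinuousLinearMap.adjoint_comp, hPa, hDa] at h
  have h3 : D (B (D v)) = D (T.starProjection (B (T.starProjection (D v)))) := by
    rw [Submodule.starProjection_eq_self_iff.2 (hDT v)]
    exact (congrArg (fun F : MatSpace M N →L[ℝ] MatSpace M N => F (B (D v))) h2).symm
  rw [h3]
  calc _ ≤ ‖(T.starProjection ∘L B ∘L T.starProjection) (D v)‖ := hD1 _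
    _ ≤ spectralNormOn B T * ‖D v‖ := ContinuousLinearMap.le_opNorm _ _
    _ ≤ spectralNormOn B T * ‖v‖ := by
        gcongr
        · exact norm_nonneg _
        · exact hD1 v

/-- One step of Riemannian iterative hard thresholding with unit step size, from `X` to `Y`. -/
def IsRiemannianIHTStep (A : MatSpace M N →L[ℝ] EuclideanSpace ℝ (Fin m))
    (y : EuclideanSpace ℝ (Fin m)) (k s : ℕ) (X Y : MatSpace M N) : Prop :=
  ∃ G : MatSpace M N, IsMetricProj (tangentConeAt ℝ (lowRank M N k) X) (costGrad A y X) G ∧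
    IsQuasiProj k s (X - G) Y

theorem costGrad_eq (A : MatSpace M N →L[ℝ] EuclideanSpace ℝ (Fin m)) (X P : MatSpace M N) :
    costGrad A (A P) X = ContinuousLinearMap.adjoint A (A (X - P)) := by
  rw [costGrad, map_sub A]

/-- The restriction to rows containing the nonzero rows of `P` maps tangent vectors of
`lowRank M N k` at `P` to tangent vectors of `lowRankSupported N k S` at `P`. -/
theorem rowRestrictL_mem_tangentConeAt {S : Finset (Fin M)} {P V : MatSpace M N}
    (hP : P.rowSupport ⊆ S) (hV : V ∈ tangentConeAt ℝ (lowRank M N k) P) :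
    rowRestrictL N S V ∈ tangentConeAt ℝ (lowRankSupported N k S) P := by
  have h1 : HasFDerivWithinAt (rowRestrictL N S) (rowRestrictL N S) (lowRank M N k) P :=
    (rowRestrictL N S).hasFDerivWithinAt
  have h2 := h1.mapsTo_tangent_cone hV
  rw [rowRestrictL_apply S P, rowRestrict_eq_self hP] at h2
  refine tangentConeAt_mono ?_ h2
  rintro _ ⟨Z, hZ, rfl⟩
  exact ⟨rowRestrict_mem_lowRank S hZ, rowSupport_rowRestrict_subset S Z⟩

/-- First-order expansion of one step of the method around a solution: up to `o(‖X - P‖)`, the error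
is multiplied by a compression of `1 - A* A`. -/
theorem IsRiemannianIHTStep.isLittleO {A : MatSpace M N →L[ℝ] EuclideanSpace ℝ (Fin m)}
    {P : MatSpace M N} (hP : P.toMatrix.rank = k) (hs : P.rowSupport.card = s) :
    ∃ D : MatSpace M N →L[ℝ] MatSpace M N, ContinuousLinearMap.adjoint D = D ∧
      (∀ v, ‖D v‖ ≤ ‖v‖) ∧ (∀ v, D v ∈ tangentSpaceOf (lowRankSupported N k P.rowSupport) P) ∧
      ∀ {ι : Type} {l : Filter ι} {X Y : ι → MatSpace M N}, Tendsto X l (𝓝 P) →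
        (∀ᶠ i in l, X i ∈ lowRankSparse M N k s ∧ IsRiemannianIHTStep A (A P) k s (X i) (Y i)) →
        (fun i => (Y i - P) - D ((ContinuousLinearMap.id ℝ (MatSpace M N) -
          ContinuousLinearMap.adjoint A ∘L A) (D (X i - P)))) =o[l] fun i => X i - P := by
  obtain ⟨R, L, hL, hR⟩ := exists_hasLocalRetractionAt_lowRank hP
  have hRP := hR.self_of_nhds hP.le
  set S := P.rowSupport with hS
  set D := rowRestrictL N S with hD
  set Q := (L P).range.starProjection with hQ
  set F := ContinuousLinearMap.adjoint A ∘L A with hF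
  have hDa : ContinuousLinearMap.adjoint D = D := adjoint_rowRestrictL S
  have hQa : ContinuousLinearMap.adjoint Q = Q :=
    ContinuousLinearMap.isSelfAdjoint_iff'.1 (isSelfAdjoint_starProjection _)
  have hDP : D P = P := rowRestrict_eq_self subset_rfl
  have hDT : ∀ v ∈ (L P).range, D v ∈ tangentConeAt ℝ (lowRankSupported N k S) P := by
    intro v hv
    refine rowRestrictL_mem_tangentConeAt subset_rfl ?_
    rw [hRP.tangentConeAt_eq]
    exact hv
  -- Matrices supported in `S` form a subset of `lowRank`, so the restricted tangent vectors are
  -- still tangent to `lowRank`.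
  have hDinv : ∀ v ∈ (L P).range, D v ∈ (L P).range := by
    intro v hv
    have h1 := tangentConeAt_mono (fun Z hZ => hZ.1) (hDT v hv) (t := lowRank M N k)
    rwa [hRP.tangentConeAt_eq] at h1
  have hcomm : ∀ v, Q (D v) = D (Q v) :=
    Submodule.starProjection_comm_of_invariant hDa hDinv
  have hQQ : ∀ v, Q (Q v) = Q v := fun v =>
    Submodule.starProjection_eq_self_iff.2 ((L P).range.starProjection_apply_mem v)
  refine ⟨D ∘L Q, ?_, ?_, ?_, ?_⟩
  · rw [ContinuousLinearMap.adjoint_comp, hDa, hQa]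
    exact ContinuousLinearMap.ext hcomm
  · exact fun v => (norm_rowRestrictL_le S _).trans ((L P).range.norm_starProjection_apply_le v)
  · exact fun v => Submodule.subset_span (hDT _ ((L P).range.starProjection_apply_mem v))
  intro ι l X Y hX hstep
  have hev : ∀ᶠ i in l, X i ∈ lowRank M N k ∧ D (X i) = X i ∧
      HasLocalRetractionAt R (L (X i)) (lowRank M N k) (X i) ∧
      IsQuasiProj k s (X i - (L (X i)).range.starProjection (F (X i - P))) (Y i) := by
    filter_upwards [hstep, hX.eventually hR, hX.eventually (eventually_rowSupport_eq hs)]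
      with i hi hi1 hi2
    obtain ⟨hmem, G, hG, hY⟩ := hi
    have hret := hi1 hmem.1
    refine ⟨hmem.1, rowRestrict_eq_self (hi2 hmem.2).le, hret, ?_⟩
    obtain ⟨hG1, hG2⟩ := hG
    rw [hret.tangentConeAt_eq] at hG1 hG2
    rw [costGrad_eq] at hG2
    have hGeq : G = (L (X i)).range.starProjection (F (X i - P)) :=
      Submodule.eq_starProjection_of_forall_norm_sub_le hG1 hG2
    rwa [← hGeq]
  set G := fun i => (L (X i)).range.starProjection (F (X i - P)) with hG
  have hFO : (fun i => F (X i - P)) =O[l] fun i => X i - P := F.isBigO_comp _ _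
  have hGO : (fun i => G i) =O[l] fun i => X i - P := by
    refine (IsBigO.of_bound 1 (Eventually.of_forall fun i => ?_)).trans hFO
    rw [one_mul]
    exact (L (X i)).range.norm_starProjection_apply_le _
  have hX0 : Tendsto (fun i => X i - P) l (𝓝 0) := by simpa using hX.sub_const P
  -- Replacing the tangent space at `X i` by the one at `P` costs a factor tending to zero, since
  -- `L` is continuous at `P`.
  have hGQ : (fun i => G i - Q (F (X i - P))) =o[l] fun i => X i - P := by
    have h1 : Tendsto (fun i => 2 * ‖L (X i) - L P‖) l (𝓝 0) := by
      have h2 := ((hL.tendsto.comp hX).sub_const (L P)).norm.const_mul 2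
      simpa using h2
    have h2 : (fun i => G i - Q (F (X i - P))) =O[l] fun i =>
        (2 * ‖L (X i) - L P‖) * ‖X i - P‖ := by
      have h3 : (fun i => G i - Q (F (X i - P))) =O[l] fun i =>
          (2 * ‖L (X i) - L P‖) * ‖F (X i - P)‖ := by
        refine IsBigO.of_bound 1 ?_
        filter_upwards [hev] with i hi
        rw [Real.norm_of_nonneg (by positivity), one_mul]
        calc ‖G i - Q (F (X i - P))‖
            = ‖((L (X i)).range.starProjection - Q) (F (X i - P))‖ := rfl
          _ ≤ ‖(L (X i)).range.starProjection - Q‖ * ‖F (X i - P)‖ :=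
              ContinuousLinearMap.le_opNorm _ _
          _ ≤ _ := by
              gcongr
              exact norm_starProjection_range_sub_le hi.2.2.1.idempotent hRP.idempotent
      exact h3.trans ((isBigO_refl _ _).mul hFO.norm_norm)
    have h4 := ((isLittleO_one_iff ℝ).2 h1).mul_isBigO (isBigO_refl (fun i => ‖X i - P‖) l)
    simp only [one_mul] at h4
    exact (h2.trans_isLittleO h4).of_norm_right
  have hZ : Tendsto (fun i => X i - G i) l (𝓝 P) := by
    simpa using hX.sub (hGO.trans_tendsto hX0)
  have hW : Tendsto (fun i => D (X i - G i)) l (𝓝 P) := by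
    have h1 := (D.continuous.tendsto P).comp hZ
    rwa [hDP] at h1
  have hYW : ∀ᶠ i in l, Y i ∈ lowRank M N k ∧
      ∀ Z ∈ lowRank M N k, ‖D (X i - G i) - Y i‖ ≤ ‖D (X i - G i) - Z‖ := by
    filter_upwards [hev, hZ.eventually (eventually_isHardThreshold_eq hs)] with i hi hi'
    obtain ⟨W, hW1, hW2⟩ := hi.2.2.2
    rw [hi' W hW1] at hW2
    exact hW2
  have hWO : (fun i => D (X i - G i) - P) =O[l] fun i => X i - P := by
    have h1 := (D.isBigO_comp (fun i => X i - P - G i) l).trans ((isBigO_refl _ _).sub hGO)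
    refine h1.congr_left fun i => ?_
    rw [map_sub, map_sub, map_sub, hDP]
    abel
  have hproj := (hRP.metricProj_isLittleO hW hYW).trans_isBigO hWO
  have htan := hRP.sub_starProjection_isLittleO hX (hev.mono fun i hi => hi.1)
  rw [← hQ] at hproj htan
  -- With `v = X i - P`, the projection gives `Y i - P ≈ Qv - DQ(G i)`. Now `h1` replaces `G i` by
  -- `QFv`, and `h2` replaces `v` by `Qv` inside `F`. As `Dv = v`, the result is `DQ(1 - F)DQv`.
  have h1 := ((D ∘L Q).isBigO_comp _ l).trans_isLittleO hGQ
  have h2 := ((D ∘L Q ∘L F ∘L D).isBigO_comp _ l).trans_isLittleO htan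
  refine ((hproj.sub h1).sub h2).congr' ?_ EventuallyEq.rfl
  filter_upwards [hev] with i hi
  have e1 : D (X i - P) = X i - P := by rw [map_sub, hi.2.1, hDP]
  have e2 : D (X i - G i) - P = (X i - P) - D (G i) := by
    rw [map_sub, hi.2.1]
    abel
  rw [e2]
  simp only [ContinuousLinearMap.comp_apply, sub_apply, ContinuousLinearMap.id_apply]
  generalize hv : X i - P = v at *
  have e3 : D (Q v) = Q v := by rw [← hcomm, e1]
  simp only [map_sub, hcomm, hQQ, e1, e3]
  abel

/-- Local contraction of one step, with any rate larger than `δ`. -/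
theorem IsRiemannianIHTStep.exists_contraction {A : MatSpace M N →L[ℝ] EuclideanSpace ℝ (Fin m)}
    {P : MatSpace M N} (hP : P.toMatrix.rank = k) (hs : P.rowSupport.card = s) {r : ℝ}
    (hr : spectralNormOn (ContinuousLinearMap.id ℝ (MatSpace M N) -
        ContinuousLinearMap.adjoint A ∘L A)
      (tangentSpaceOf (lowRankSupported N k P.rowSupport) P) < r) :
    ∃ ε : ℝ, 0 < ε ∧ ∀ X Y, X ∈ lowRankSparse M N k s → IsRiemannianIHTStep A (A P) k s X Y →
      ‖X - P‖ ≤ ε → ‖Y - P‖ ≤ r * ‖X - P‖ := by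
  obtain ⟨D, hDa, hD1, hDT, hD⟩ := IsRiemannianIHTStep.isLittleO (A := A) hP hs
  set B := ContinuousLinearMap.id ℝ (MatSpace M N) - ContinuousLinearMap.adjoint A ∘L A
  set δ := spectralNormOn B (tangentSpaceOf (lowRankSupported N k P.rowSupport) P)
  -- A filter on all pairs (iterate, successor) makes the little-o uniform over every admissible
  -- choice, so `ε` depends on no particular sequence.
  set l : Filter (MatSpace M N × MatSpace M N) := comap Prod.fst (𝓝 P) ⊓
    𝓟 {q | q.1 ∈ lowRankSparse M N k s ∧ IsRiemannianIHTStep A (A P) k s q.1 q.2} with hl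
  have h1 := hD (l := l) (X := Prod.fst) (Y := Prod.snd) (tendsto_comap.mono_left inf_le_left)
    (eventually_inf_principal.2 (Eventually.of_forall fun q hq => hq))
  have h2 := h1.def (sub_pos.2 hr)
  rw [hl, eventually_inf_principal, eventually_comap] at h2
  obtain ⟨ε, hε, hball⟩ := Metric.nhds_basis_closedBall.eventually_iff.1 h2
  refine ⟨ε, hε, fun X Y hX hXY hle => ?_⟩
  have h3 := hball (mem_closedBall_iff_norm.2 hle) (X, Y) rfl ⟨hX, hXY⟩
  have h4 : ‖D (B (D (X - P)))‖ ≤ δ * ‖X - P‖ := norm_compression_apply_le hDa hD1 hDT _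
  calc ‖Y - P‖ = ‖((Y - P) - D (B (D (X - P)))) + D (B (D (X - P)))‖ := by
        rw [sub_add_cancel]
    _ ≤ (r - δ) * ‖X - P‖ + δ * ‖X - P‖ := (norm_add_le _ _).trans (add_le_add h3 h4)
    _ = r * ‖X - P‖ := by ring

theorem IsRiemannianIHT.mem_lowRankSparse {A : MatSpace M N →L[ℝ] EuclideanSpace ℝ (Fin m)}
    {y : EuclideanSpace ℝ (Fin m)} {α : ℕ → ℝ} {X : ℕ → MatSpace M N}
    (h : IsRiemannianIHT A y k s α X) {ℓ : ℕ} (hℓ : 1 ≤ ℓ) : X ℓ ∈ lowRankSparse M N k s := by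
  obtain ⟨n, rfl⟩ := Nat.exists_eq_add_of_le' hℓ
  cases n with
  | zero => exact h.start
  | succ n =>
    obtain ⟨G, -, hG⟩ := h.step (n + 1) (by omega)
    exact hG.mem_lowRankSparse

end LocalConvergence

/-- Local convergence of Riemannian iterative hard thresholding with unit step size, at asymptotic
rate at most `δ`. In the quotient of extended nonnegative reals, `0 / 0 = 0` and `a / 0 = ∞` for
`a > 0`. -/
theorem mainTheorem4 (M N m k s : ℕ) (hks : k ≤ s)
    (A : MatSpace M N →L[ℝ] EuclideanSpace ℝ (Fin m)) (y : EuclideanSpace ℝ (Fin m))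
    (Xs : MatSpace M N) (hsol : A Xs = y ∧ Xs ∈ lowRankSparse M N k s)
    (hrows : Xs.rowSupport.card = s) (hrank : Xs.toMatrix.rank = min k s)
    (δ : ℝ)
    (hδ : spectralNormOn (ContinuousLinearMap.id ℝ (MatSpace M N) -
        ContinuousLinearMap.adjoint A ∘L A)
      (tangentSpaceOf (lowRankSupported N k Xs.rowSupport) Xs) = δ)
    (hδ1 : δ < 1) :
    ∃ ε : ℝ, 0 < ε ∧ ∀ X : ℕ → MatSpace M N,
      IsRiemannianIHT A y k s (fun _ => 1) X →
      (∃ ℓ, 1 ≤ ℓ ∧ ‖X ℓ - Xs‖ ≤ ε) →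
      Tendsto X atTop (𝓝 Xs) ∧
      limsup (fun ℓ => ‖X (ℓ + 1) - Xs‖ₑ / ‖X ℓ - Xs‖ₑ) atTop ≤ ENNReal.ofReal δ := by
  obtain ⟨rfl, -⟩ := hsol
  rw [min_eq_left hks] at hrank
  have hδ0 : 0 ≤ δ := hδ ▸ norm_nonneg _
  -- A rate `r < 1` keeps the iterates in the `ε`-ball and yields geometric convergence.
  obtain ⟨r, hδr, hr1⟩ := exists_between hδ1
  have hr0 : 0 ≤ r := hδ0.trans hδr.le
  obtain ⟨ε, hε, hcontr⟩ :=
    IsRiemannianIHTStep.exists_contraction (A := A) hrank hrows (hδ.trans_lt hδr)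
  refine ⟨ε, hε, fun X hX ⟨n, hn, hle⟩ => ?_⟩
  have hmem : ∀ ℓ, 1 ≤ ℓ → X ℓ ∈ lowRankSparse M N k s := fun ℓ hℓ => hX.mem_lowRankSparse hℓ
  have hstep : ∀ ℓ, 1 ≤ ℓ → IsRiemannianIHTStep A (A Xs) k s (X ℓ) (X (ℓ + 1)) := by
    intro ℓ hℓ
    obtain ⟨G, hG, hY⟩ := hX.step ℓ hℓ
    exact ⟨G, hG, by simpa using hY⟩
  have hgeom : ∀ j, ‖X (j + n) - Xs‖ ≤ r ^ j * ‖X n - Xs‖ := by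
    intro j
    induction j with
    | zero => simp
    | succ j ih =>
      have h1 : ‖X (j + n) - Xs‖ ≤ ε := by
        refine ih.trans (le_trans ?_ hle)
        exact mul_le_of_le_one_left (norm_nonneg _) (pow_le_one₀ hr0 hr1.le)
      have h2 := hcontr _ _ (hmem (j + n) (by omega)) (hstep (j + n) (by omega)) h1
      rw [show j + 1 + n = j + n + 1 by omega]
      calc ‖X (j + n + 1) - Xs‖ ≤ r * ‖X (j + n) - Xs‖ := h2
        _ ≤ r * (r ^ j * ‖X n - Xs‖) := by gcongr
        _ = r ^ (j + 1) * ‖X n - Xs‖ := by ring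
  have htend : Tendsto X atTop (𝓝 Xs) := by
    rw [← tendsto_add_atTop_iff_nat n, tendsto_iff_norm_sub_tendsto_zero]
    refine squeeze_zero (fun _ => norm_nonneg _) hgeom ?_
    simpa using (tendsto_pow_atTop_nhds_zero_of_lt_one hr0 hr1).mul_const ‖X n - Xs‖
  refine ⟨htend, ?_⟩
  -- The radius for a rate `a` above `δ` may be smaller than `ε`, but convergence brings the tail
  -- inside it.
  refine le_of_forall_gt_imp_ge_of_dense fun a ha => ?_
  rcases eq_or_ne a ⊤ with rfl | hatop
  · exact le_top
  have hδa : δ < a.toReal := (ENNReal.ofReal_lt_iff_lt_toReal hδ0 hatop).1 ha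
  obtain ⟨η, hη, hcontr'⟩ :=
    IsRiemannianIHTStep.exists_contraction (A := A) hrank hrows (hδ.trans_lt hδa)
  refine limsup_le_of_le (h := ?_)
  have hnear : ∀ᶠ ℓ in atTop, ‖X ℓ - Xs‖ ≤ η :=
    (htend.eventually (Metric.closedBall_mem_nhds Xs hη)).mono fun ℓ h =>
      mem_closedBall_iff_norm.1 h
  filter_upwards [hnear, eventually_ge_atTop 1] with ℓ hℓ hℓ1
  have h1 := hcontr' _ _ (hmem ℓ hℓ1) (hstep ℓ hℓ1) hℓ
  -- The product form includes `X ℓ = Xs`: then the next error vanishes too, and `0 / 0 = 0`.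
  refine ENNReal.div_le_of_le_mul ?_
  rw [← ofReal_norm, ← ofReal_norm, ← ENNReal.ofReal_toReal hatop,
    ← ENNReal.ofReal_mul ENNReal.toReal_nonneg]
  exact ENNReal.ofReal_le_ofReal h1
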